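/- Let $0<\varepsilon<1$. There is a constant $c>0$, depending only on $\varepsilon$, such that for every dimension $d\ge 2$ and every integer $M\ge 1$ there is a function of $d$-dimensional quantum states of the form $$f_M(\rho)=\mathrm{tr}\big[O\,U_M\,\sigma\,U_M^\dagger\big],\qquad U_M=V_M\,(e^{-i\rho T_M}\otimes \mathbf 1)\,V_{M-1}\cdots V_1\,(e^{-i\rho T_1}\otimes\mathbf 1)\,V_0,$$ with the following property. Here $V_0,\dots,V_M$ are fixed unitaries on $\mathbb C^d\otimes\mathbb C^a$ for some finite ancilla dimension $a$, the times satisfy $|T_m|\le 1$, $O$ is a fixed observable with $-\mathbf 1\le O\le \mathbf 1$, and the initial state is either a fixed state $\sigma$ or $\sigma=\rho\otimes\tau$ with a fixed ancilla state $\tau$. Let $\mathcal A$ be any quantum algorithm (which may depend on the description of $f_M$), that is, any quantum measurement of $\rho^{\otimes k}$ with real outcomes (a POVM on $\mathbb R$), such that for every $d$-dimensional state $\rho$ its outcome is within $\varepsilon$ of $f_M(\rho)$ with probability at least $2/3$. Then $k\ge c\,M^2$; that is, $k=\Omega(M^2)$ copies of $\rho$ are required. With the same $f_M$ and $c$, the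 bound $k\ge c\,M^2$ also holds if $\mathcal A$ is only required to succeed on all pure states $\rho$. -/

import Mathlib

open scoped Kronecker ComplexOrder

noncomputable section

/-- A quantum state: a positive semidefinite complex matrix of trace one. -/
structure DensityMatrix (n : Type) [Fintype n] where
  toMatrix : Matrix n n ℂ
  posSemidef : toMatrix.PosSemidef
  trace_eq_one : toMatrix.trace = 1

/-- A pure state is of the form `|ψ⟩⟨ψ|`; the vector `ψ` is automatically of unit norm,
since the trace is one. -/
def DensityMatrix.IsPure {n : Type} [Fintype n] (ρ : DensityMatrix n) : Prop :=
  ∃ ψ : n → ℂ, ρ.toMatrix = Matrix.vecMulVec ψ (star ψ)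

/-- The density matrix exponential `e^{-iρT}`. -/
def dmExp {n : Type} [Fintype n] [DecidableEq n] (ρ : DensityMatrix n) (T : ℝ) :
    Matrix n n ℂ :=
  NormedSpace.exp ((-(Complex.I * (T : ℂ))) • ρ.toMatrix)

/-- The circuit
`V_M (e^{-iρT_M} ⊗ 1) V_{M-1} ⋯ (e^{-iρT_2} ⊗ 1) V_1 (e^{-iρT_1} ⊗ 1) V_0`
on a `d`-dimensional register (on which the exponentials act) and an `a`-dimensional ancilla;
`T_1, …, T_M` are stored as `T 0, …, T (M - 1)`. -/
def dmeCircuit {d a : ℕ} (ρ : DensityMatrix (Fin d)) :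
    (M : ℕ) → (Fin (M + 1) → Matrix (Fin d × Fin a) (Fin d × Fin a) ℂ) → (Fin M → ℝ) →
      Matrix (Fin d × Fin a) (Fin d × Fin a) ℂ
  | 0, V, _ => V 0
  | M + 1, V, T =>
      V (Fin.last (M + 1)) *
        (dmExp ρ (T (Fin.last M)) ⊗ₖ (1 : Matrix (Fin a) (Fin a) ℂ)) *
        dmeCircuit ρ M (fun i => V i.castSucc) (fun i => T i.castSucc)

/-- The initial state of the circuit: either a known state of the whole system, or a copy of
the unknown state `ρ` next to a known ancilla state. -/
inductive InitialState (d a : ℕ) where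
  | known (τ : DensityMatrix (Fin d × Fin a))
  | withCopy (τ : DensityMatrix (Fin a))

/-- The matrix of the initial state: `τ`, respectively `ρ ⊗ τ`. -/
def InitialState.toMatrix {d a : ℕ} (σ : InitialState d a) (ρ : DensityMatrix (Fin d)) :
    Matrix (Fin d × Fin a) (Fin d × Fin a) ℂ :=
  match σ with
  | .known τ => τ.toMatrix
  | .withCopy τ => ρ.toMatrix ⊗ₖ τ.toMatrix

/-- The description of a function `f_M(ρ) = tr[O U_M σ U_M†]` of a `d`-dimensional state `ρ`,
where `U_M` contains `M` density matrix exponentials of times at most one in absolute value,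
interleaved with known unitaries, and `O` is an observable with `-1 ≤ O ≤ 1`. -/
structure DMEFunction (d M : ℕ) where
  /-- dimension of the ancilla -/
  a : ℕ
  /-- the known unitaries -/
  V : Fin (M + 1) → Matrix.unitaryGroup (Fin d × Fin a) ℂ
  /-- the evolution times -/
  T : Fin M → ℝ
  abs_T_le_one : ∀ m, |T m| ≤ 1
  /-- the initial state -/
  σ : InitialState d a
  /-- the observable -/
  O : Matrix (Fin d × Fin a) (Fin d × Fin a) ℂ
  isHermitian_O : O.IsHermitian
  O_le_one : (1 - O).PosSemidef
  neg_one_le_O : (1 + O).PosSemidef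

/-- The unitary `U_M`. -/
def DMEFunction.unitary {d M : ℕ} (f : DMEFunction d M) (ρ : DensityMatrix (Fin d)) :
    Matrix (Fin d × Fin f.a) (Fin d × Fin f.a) ℂ :=
  dmeCircuit ρ M (fun i => (f.V i : Matrix (Fin d × Fin f.a) (Fin d × Fin f.a) ℂ)) f.T

/-- The expectation value `f_M(ρ) = tr[O U_M σ U_M†]`. -/
def DMEFunction.value {d M : ℕ} (f : DMEFunction d M) (ρ : DensityMatrix (Fin d)) : ℝ :=
  (f.O * f.unitary ρ * f.σ.toMatrix ρ * (f.unitary ρ).conjTranspose).trace.re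

/-- The matrix of `ρ^{⊗k}`, on the space with basis `Fin k → Fin d`. -/
def copies {d : ℕ} (ρ : DensityMatrix (Fin d)) (k : ℕ) :
    Matrix (Fin k → Fin d) (Fin k → Fin d) ℂ :=
  Matrix.of fun i j => ∏ m, ρ.toMatrix (i m) (j m)

/-- A quantum algorithm that receives `k` copies of a `d`-dimensional state and outputs a real
number, up to the statistics of its output: a positive operator-valued measure on the Borel
sets of `ℝ`. Every procedure made of ancillas, quantum channels, (adaptive) measurements and
classical randomness and post-processing is of this form. -/
structure QuantumEstimator (d k : ℕ) where
  effect : Set ℝ → Matrix (Fin k → Fin d) (Fin k → Fin d) ℂ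
  posSemidef : ∀ S, MeasurableSet S → (effect S).PosSemidef
  effect_univ : effect Set.univ = 1
  hasSum_effect : ∀ S : ℕ → Set ℝ, (∀ i, MeasurableSet (S i)) →
    Pairwise (fun i j => Disjoint (S i) (S j)) →
    HasSum (fun i => effect (S i)) (effect (⋃ i, S i))

/-- The probability that the output lies in `S` on input `ρ^{⊗k}`. -/
def QuantumEstimator.prob {d k : ℕ} (A : QuantumEstimator d k) (ρ : DensityMatrix (Fin d))
    (S : Set ℝ) : ℝ :=
  (A.effect S * copies ρ k).trace.re

/-- On every input state in `D`, the output of `A` is within `ε` of `f ρ` with probability at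
least `2/3`. -/
def QuantumEstimator.Estimates {d k : ℕ} (A : QuantumEstimator d k)
    (f : DensityMatrix (Fin d) → ℝ) (ε : ℝ) (D : Set (DensityMatrix (Fin d))) : Prop :=
  ∀ ρ ∈ D, 2 / 3 ≤ A.prob ρ {x | |x - f ρ| ≤ ε}

end

/-!
The hard function is a circuit that distinguishes two nearby pure states perfectly.

Let `A, B = (cos α, ± sin α)` be real unit vectors in a coordinate plane `span {e₀, e₁}`, and let
`U_A = e^{-i|A⟩⟨A|}`, `U_B = e^{-i|B⟩⟨B|}`. Take `T_m = 1`, `V_0 = 1` and `V_m = U_A†` for `m ≥ 1`, so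
that `U_M = (U_A† e^{-iρ})^M`; start in `e₀` and measure `O = 2|e₀⟩⟨e₀| - 1`. On `ρ = |A⟩⟨A|` the
circuit is the identity and the value is `1`. On `ρ = |B⟩⟨B|` it is the `M`-th power of `U_A† U_B`,
which acts on the plane, up to a phase of `e₁`, as the rotation by the angle `θ` with
`sin (θ / 2) = sin (1 / 2) * sin (2α)` (`phaseGate_mul_phaseGate_mulVec_planeVec`). Choosing `α` such
that `sin (1 / 2) * sin (2α) = sin (π / (4M))` gives `Mθ = π / 2`; then `e₀` is carried to a multiple
of `e₁`, and the value is `-1` (`echo_pow_mulVec`). Such an `α` exists as soon as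
`sin (π / (4M)) ≤ sin (1 / 2)`, that is, for `M ≥ 2`. For `M = 1` the overlap `tr[Oρ]` of `ρ` itself
separates `e₀` from `e₁`.

An estimator with error `ε < 1` tells the values `1` and `-1` apart, so it distinguishes `A^{⊗k}` from
`B^{⊗k}`. These vectors have inner product `⟨A, B⟩^k ≥ 1 - k (1 - ⟨A, B⟩)`, and their distance has to
be bounded below, hence `k (1 - ⟨A, B⟩) ≥ 1 / 36` (`QuantumEstimator.Estimates.le_copies_mul`). Since
`1 - ⟨A, B⟩ ≤ sin² (2α) = O(1 / M²)`, this gives `k = Ω(M²)`. Both states are pure, so the argument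
covers estimators that are only correct on pure states.
-/

open Matrix

/-! ### Exponentials of pure states -/

/-- Since `P ^ k = P` for `k ≥ 1`, the exponential series differs from that of `exp c • P` only in
its constant term. -/
theorem exp_smul_of_isIdempotentElem {n : Type} [Fintype n] [DecidableEq n] {P : Matrix n n ℂ}
    (hP : IsIdempotentElem P) (c : ℂ) :
    NormedSpace.exp (c • P) = 1 + (Complex.exp c - 1) • P := by
  have h1 : HasSum (fun k : ℕ => ((k.factorial : ℂ)⁻¹ * c ^ k) • P) (Complex.exp c • P) := by
    have := NormedSpace.exp_series_hasSum_exp' (𝕂 := ℂ) c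
    rw [← Complex.exp_eq_exp_ℂ] at this
    simpa [smul_eq_mul] using this.smul_const P
  have h2 : HasSum (fun k : ℕ => if k = 0 then 1 - P else 0) (1 - P) := hasSum_ite_eq 0 (1 - P)
  have h3 : (fun k : ℕ => ((k.factorial : ℂ)⁻¹) • (c • P) ^ k) =
      fun k : ℕ => ((k.factorial : ℂ)⁻¹ * c ^ k) • P + (if k = 0 then 1 - P else 0) := by
    funext k
    rcases k with _ | k
    · simp
    · simp [smul_pow, hP.pow_succ_eq, smul_smul]
  rw [NormedSpace.exp_eq_tsum ℂ]
  simp only [h3]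
  rw [(h1.add h2).tsum_eq, sub_smul, one_smul]
  abel

/-- The pure state `|ψ⟩⟨ψ|` of a unit vector `ψ`. -/
noncomputable def pureState {n : Type} [Fintype n] (ψ : n → ℂ) (h : star ψ ⬝ᵥ ψ = 1) :
    DensityMatrix n where
  toMatrix := vecMulVec ψ (star ψ)
  posSemidef := posSemidef_vecMulVec_self_star ψ
  trace_eq_one := by rw [trace_vecMulVec, dotProduct_comm, h]

theorem pureState_isPure {n : Type} [Fintype n] (ψ : n → ℂ) (h : star ψ ⬝ᵥ ψ = 1) :
    (pureState ψ h).IsPure := ⟨ψ, rfl⟩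

section Gate

variable {n : Type}

theorem isIdempotentElem_vecMulVec_star [Fintype n] {ψ : n → ℂ} (h : star ψ ⬝ᵥ ψ = 1) :
    IsIdempotentElem (vecMulVec ψ (star ψ)) := by
  rw [IsIdempotentElem, vecMulVec_mul_vecMulVec, h, one_smul]

/-- The gate that multiplies the unit vector `ψ` by `z` and fixes its orthogonal complement. -/
noncomputable def phaseGate [DecidableEq n] (ψ : n → ℂ) (z : ℂ) : Matrix n n ℂ :=
  1 + (z - 1) • vecMulVec ψ (star ψ)

theorem dmExp_pureState [Fintype n] [DecidableEq n] (ψ : n → ℂ) (h : star ψ ⬝ᵥ ψ = 1) (T : ℝ) :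
    dmExp (pureState ψ h) T = phaseGate ψ (Complex.exp (-(Complex.I * T))) :=
  exp_smul_of_isIdempotentElem (isIdempotentElem_vecMulVec_star h) _

theorem phaseGate_mul_phaseGate [Fintype n] [DecidableEq n] {ψ : n → ℂ} (h : star ψ ⬝ᵥ ψ = 1)
    (z w : ℂ) :
    phaseGate ψ z * phaseGate ψ w = phaseGate ψ (z * w) := by
  have hP := isIdempotentElem_vecMulVec_star h
  simp only [phaseGate, mul_add, add_mul, one_mul, mul_one, smul_mul_smul_comm, hP.eq]
  module

theorem phaseGate_one [DecidableEq n] (ψ : n → ℂ) : phaseGate ψ 1 = 1 := by simp [phaseGate]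

theorem conjTranspose_phaseGate [DecidableEq n] (ψ : n → ℂ) (z : ℂ) :
    (phaseGate ψ z)ᴴ = phaseGate ψ (star z) := by
  simp [phaseGate, conjTranspose_vecMulVec]

theorem phaseGate_mulVec [Fintype n] [DecidableEq n] (ψ v : n → ℂ) (z : ℂ) :
    phaseGate ψ z *ᵥ v = v + ((z - 1) * (star ψ ⬝ᵥ v)) • ψ := by
  simp [phaseGate, add_mulVec, smul_mulVec, vecMulVec_mulVec, mul_smul]

theorem phaseGate_kronecker_one_mem_unitaryGroup [Fintype n] [DecidableEq n] {ψ : n → ℂ}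
    (h : star ψ ⬝ᵥ ψ = 1) {z : ℂ} (hz : z * star z = 1) (m : Type) [Fintype m] [DecidableEq m] :
    phaseGate ψ z ⊗ₖ (1 : Matrix m m ℂ) ∈ unitaryGroup (n × m) ℂ := by
  rw [mem_unitaryGroup_iff, star_eq_conjTranspose, conjTranspose_kronecker, ← mul_kronecker_mul,
    conjTranspose_phaseGate, phaseGate_mul_phaseGate h, hz, phaseGate_one, conjTranspose_one,
    mul_one, one_kronecker_one]

/-- The observable `2|s⟩⟨s| - 1`, with value `1` on the unit vector `s` and `-1` on its orthogonal
complement. -/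
noncomputable def signObservable [DecidableEq n] (s : n → ℂ) : Matrix n n ℂ :=
  (2 : ℂ) • vecMulVec s (star s) - 1

theorem signObservable_isHermitian [DecidableEq n] (s : n → ℂ) : (signObservable s).IsHermitian := by
  simp [signObservable, IsHermitian, conjTranspose_vecMulVec]

theorem one_sub_signObservable_posSemidef [Fintype n] [DecidableEq n] {s : n → ℂ}
    (h : star s ⬝ᵥ s = 1) : (1 - signObservable s).PosSemidef := by
  have hP := isIdempotentElem_vecMulVec_star h
  have : 1 - signObservable s =
      (2 : ℂ) • ((1 - vecMulVec s (star s))ᴴ * (1 - vecMulVec s (star s))) := by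
    simp [signObservable, conjTranspose_vecMulVec, mul_sub, sub_mul, hP.eq]
    module
  rw [this]
  exact (posSemidef_conjTranspose_mul_self _).smul (by norm_num)

theorem one_add_signObservable_posSemidef [Fintype n] [DecidableEq n] (s : n → ℂ) :
    (1 + signObservable s).PosSemidef := by
  rw [signObservable, add_sub_cancel]
  exact (posSemidef_vecMulVec_self_star s).smul (by norm_num)

theorem trace_mul_conj_vecMulVec_star [Fintype n] (O U : Matrix n n ℂ) (v : n → ℂ) :
    (O * U * vecMulVec v (star v) * Uᴴ).trace = star (U *ᵥ v) ⬝ᵥ (O *ᵥ (U *ᵥ v)) := by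
  rw [mul_vecMulVec, vecMulVec_mul, trace_vecMulVec, ← star_mulVec, dotProduct_comm,
    mulVec_mulVec]

theorem dotProduct_signObservable_mulVec [Fintype n] [DecidableEq n] (s v : n → ℂ) :
    star v ⬝ᵥ (signObservable s *ᵥ v) =
      2 * (star s ⬝ᵥ v) * (star v ⬝ᵥ s) - star v ⬝ᵥ v := by
  simp [signObservable, sub_mulVec, smul_mulVec, vecMulVec_mulVec, mul_assoc]

end Gate

/-! ### Rotation of a coordinate plane -/

section Plane

variable {n : Type} [DecidableEq n]

/-- The vector with coordinate `x` at `i` and `y` at `j`, and zero elsewhere; meant for `i ≠ j`. -/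
noncomputable def planeVec (i j : n) (x y : ℂ) : n → ℂ := Pi.single i x + Pi.single j y

theorem star_planeVec_dotProduct [Fintype n] {i j : n} (hij : i ≠ j) (x y x' y' : ℂ) :
    star (planeVec i j x y) ⬝ᵥ planeVec i j x' y' = star x * x' + star y * y' := by
  simp [planeVec, dotProduct_add, hij, hij.symm]

theorem planeVec_add (i j : n) (x y x' y' : ℂ) :
    planeVec i j x y + planeVec i j x' y' = planeVec i j (x + x') (y + y') := by
  simp only [planeVec, Pi.single_add]
  abel

theorem smul_planeVec (i j : n) (a x y : ℂ) :
    a • planeVec i j x y = planeVec i j (a * x) (a * y) := by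
  simp [planeVec, ← Pi.single_smul]

variable [Fintype n]

/-- For real unit vectors `(c, s)` and `(c, -s)`, the product of the inverse phase gate of the first
and the phase gate of the second acts on the plane by a matrix of the form `[[C, -t̄], [t, C]]` with
real `C`. -/
theorem phaseGate_mul_phaseGate_mulVec_planeVec {i j : n} (hij : i ≠ j) (c s : ℝ)
    (hcs : c ^ 2 + s ^ 2 = 1) {ω : ℂ} (hω : star ω * ω = 1) (x y : ℂ) :
    (phaseGate (planeVec i j c s) (star ω) * phaseGate (planeVec i j c (-s)) ω) *ᵥ
        planeVec i j x y =
      planeVec i j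
        ((1 - 2 * (2 - ω - star ω) * c ^ 2 * s ^ 2) * x -
          star (c * s * (star ω - ω + (2 - ω - star ω) * (c ^ 2 - s ^ 2))) * y)
        (c * s * (star ω - ω + (2 - ω - star ω) * (c ^ 2 - s ^ 2)) * x +
          (1 - 2 * (2 - ω - star ω) * c ^ 2 * s ^ 2) * y) := by
  have hc : (c : ℂ) ^ 2 + (s : ℂ) ^ 2 = 1 := by exact_mod_cast hcs
  rw [← mulVec_mulVec, phaseGate_mulVec, phaseGate_mulVec]
  simp only [star_planeVec_dotProduct hij, smul_planeVec, planeVec_add, star_add, star_sub,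
    star_mul', star_pow, star_neg, star_ofNat, Complex.star_def, Complex.conj_ofReal,
    Complex.conj_conj] at hω ⊢
  generalize (starRingEnd ℂ) ω = ω' at hω ⊢
  generalize (c : ℂ) = c at hc ⊢
  generalize (s : ℂ) = s at hc ⊢
  congr 1
  · linear_combination (c * (c * x - s * y) * (c ^ 2 - s ^ 2)) * hω +
      ((2 - ω - ω') * c ^ 2 * x) * hc
  · linear_combination (s * (c * x - s * y) * (c ^ 2 - s ^ 2)) * hω +
      ((2 - ω - ω') * s ^ 2 * y) * hc

/-- The matrix of `G` on the plane is the rotation by `θ` in the basis `e_i, τ e_j`. -/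
theorem pow_mulVec_planeVec {i j : n} {G : Matrix n n ℂ} {θ : ℝ} {τ : ℂ}
    (hτ : star τ * τ = 1)
    (hG : ∀ x y : ℂ, G *ᵥ planeVec i j x y =
      planeVec i j (Real.cos θ * x - star (τ * Real.sin θ) * y)
        (τ * Real.sin θ * x + Real.cos θ * y)) (m : ℕ) :
    G ^ m *ᵥ planeVec i j 1 0 =
      planeVec i j (Real.cos (m * θ)) (τ * Real.sin (m * θ)) := by
  induction m with
  | zero => simp
  | succ m ih =>
    rw [pow_succ', ← mulVec_mulVec, ih, hG]
    simp only [star_mul', Complex.star_def, Complex.conj_ofReal] at hτ ⊢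
    push_cast
    rw [add_mul, one_mul, Complex.cos_add, Complex.sin_add]
    congr 1
    · linear_combination (-Complex.sin θ * Complex.sin (m * θ)) * hτ
    · ring

end Plane

/-! ### Distinguishing two pure states from copies -/

section Distinguish

/-- This is the positivity of `E` at `3v - 2u`. -/
theorem two_mul_quadForm_le {n : Type} [Fintype n] {E : Matrix n n ℂ} (hE : E.PosSemidef)
    (u v : n → ℂ) :
    2 * (star u ⬝ᵥ (E *ᵥ u)).re ≤
      3 * (star v ⬝ᵥ (E *ᵥ v)).re + 6 * (star (u - v) ⬝ᵥ (E *ᵥ (u - v))).re := by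
  have h := (Complex.le_def.1 (hE.dotProduct_mulVec_nonneg ((3 : ℂ) • v - (2 : ℂ) • u))).1
  simp only [star_sub, star_smul, mulVec_sub, mulVec_smul, dotProduct_sub, sub_dotProduct,
    smul_dotProduct, dotProduct_smul, star_ofNat, smul_eq_mul, Complex.sub_re, Complex.mul_re,
    Complex.zero_re, Complex.re_ofNat, Complex.im_ofNat] at h ⊢
  linarith

variable {d k : ℕ}

/-- The tensor power `ψ^{⊗k}`, on the index set used by `copies`. -/
noncomputable def tensorPower (ψ : Fin d → ℂ) (k : ℕ) : (Fin k → Fin d) → ℂ :=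
  fun i => ∏ m, ψ (i m)

theorem star_tensorPower_dotProduct (ψ φ : Fin d → ℂ) :
    star (tensorPower ψ k) ⬝ᵥ tensorPower φ k = (star ψ ⬝ᵥ φ) ^ k := by
  simp only [dotProduct, tensorPower, Pi.star_apply, star_prod, ← Finset.prod_mul_distrib]
  rw [Finset.sum_pow', Fintype.piFinset_univ]

theorem copies_pureState (ψ : Fin d → ℂ) (h : star ψ ⬝ᵥ ψ = 1) :
    copies (pureState ψ h) k = vecMulVec (tensorPower ψ k) (star (tensorPower ψ k)) := by
  ext i j
  simp [copies, pureState, vecMulVec_apply, tensorPower, Finset.prod_mul_distrib]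

theorem QuantumEstimator.prob_pureState (A : QuantumEstimator d k) (ψ : Fin d → ℂ)
    (h : star ψ ⬝ᵥ ψ = 1) (S : Set ℝ) :
    A.prob (pureState ψ h) S =
      (star (tensorPower ψ k) ⬝ᵥ (A.effect S *ᵥ tensorPower ψ k)).re := by
  rw [QuantumEstimator.prob, copies_pureState, mul_vecMulVec, trace_vecMulVec, dotProduct_comm]

theorem QuantumEstimator.effect_empty (A : QuantumEstimator d k) : A.effect ∅ = 0 := by
  have h := A.hasSum_effect (fun _ => ∅) (fun _ => MeasurableSet.empty)
    (fun _ _ _ => disjoint_bot_left)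
  have h' := h.summable
  rwa [summable_const_iff] at h'

theorem QuantumEstimator.effect_union (A : QuantumEstimator d k) {S R : Set ℝ}
    (hS : MeasurableSet S) (hR : MeasurableSet R) (hSR : Disjoint S R) :
    A.effect (S ∪ R) = A.effect S + A.effect R := by
  have h := A.hasSum_effect (fun i => if i = 0 then S else if i = 1 then R else ∅)
    (fun i => by split_ifs <;> simp [hS, hR])
    (fun i j hij => by
      dsimp only
      split_ifs <;> first | omega | simp [hSR.symm])
  have hU : (⋃ i : ℕ, if i = 0 then S else if i = 1 then R else ∅) = S ∪ R := by
    ext x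
    simp only [Set.mem_iUnion, Set.mem_union]
    constructor
    · rintro ⟨i, hi⟩
      split_ifs at hi
      · exact .inl hi
      · exact .inr hi
      · exact hi.elim
    · rintro (hx | hx)
      · exact ⟨0, by simpa using hx⟩
      · exact ⟨1, by simpa using hx⟩
  rw [hU] at h
  refine h.unique ?_
  have h2 := hasSum_sum_of_ne_finset_zero
    (L := SummationFilter.unconditional ℕ) (s := Finset.range 2)
    (f := fun i : ℕ => A.effect (if i = 0 then S else if i = 1 then R else ∅)) (by
      intro i hi
      have : i ≠ 0 ∧ i ≠ 1 := by simp only [Finset.mem_range] at hi; omega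
      simp [this.1, this.2, A.effect_empty])
  rw [Finset.sum_range_succ, Finset.sum_range_one] at h2
  exact h2

theorem QuantumEstimator.one_sub_effect_posSemidef (A : QuantumEstimator d k) {S : Set ℝ}
    (hS : MeasurableSet S) : (1 - A.effect S).PosSemidef := by
  have h := A.effect_union hS hS.compl disjoint_compl_right
  rw [Set.union_compl_self, A.effect_univ] at h
  rw [h, add_sub_cancel_left]
  exact A.posSemidef _ hS.compl

/-- An estimator with error below `1` for a function with values `1` and `-1` on `ψ` and `φ`
distinguishes `k` copies of `ψ` from `k` copies of `φ`, which bounds `k` below by the inverse of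
`1 - ⟨ψ, φ⟩`. -/
theorem QuantumEstimator.Estimates.le_copies_mul {A : QuantumEstimator d k}
    {f : DensityMatrix (Fin d) → ℝ} {ε : ℝ} (hε : ε < 1)
    (hA : A.Estimates f ε {ρ | ρ.IsPure}) {ψ φ : Fin d → ℂ}
    (hψ : star ψ ⬝ᵥ ψ = 1) (hφ : star φ ⬝ᵥ φ = 1) {γ : ℝ} (hγ0 : 0 ≤ γ)
    (hγ : star ψ ⬝ᵥ φ = γ) (hfψ : f (pureState ψ hψ) = 1) (hfφ : f (pureState φ hφ) = -1) :
    1 / 36 ≤ k * (1 - γ) := by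
  have h1 := hA _ (pureState_isPure ψ hψ)
  have h2 := hA _ (pureState_isPure φ hφ)
  rw [hfψ, A.prob_pureState] at h1
  rw [hfφ, A.prob_pureState] at h2
  have hmeas : ∀ a : ℝ, MeasurableSet {x : ℝ | |x - a| ≤ ε} := fun a =>
    measurableSet_le (by fun_prop) measurable_const
  have hdisj : Disjoint {x : ℝ | |x - 1| ≤ ε} {x : ℝ | |x - -1| ≤ ε} := by
    rw [Set.disjoint_left]
    intro x (hx : |x - 1| ≤ ε) (hx' : |x - -1| ≤ ε)
    have := (abs_le.1 hx).1
    have := (abs_le.1 hx').2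
    linarith
  have hunion := A.effect_union (hmeas 1) (hmeas (-1)) hdisj
  have hone := A.one_sub_effect_posSemidef ((hmeas 1).union (hmeas (-1)))
  have hone' := A.one_sub_effect_posSemidef (hmeas 1)
  have hpos := A.posSemidef _ (hmeas 1)
  rw [hunion] at hone
  generalize A.effect {x | |x - 1| ≤ ε} = E at *
  generalize A.effect {x | |x - -1| ≤ ε} = F at *
  have hdot := fun (a b : Fin d → ℂ) => star_tensorPower_dotProduct (k := k) a b
  have hψφ := hdot ψ φ
  have hφψ := hdot φ ψ
  have hψψ := hdot ψ ψ
  have hφφ := hdot φ φ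
  have hγ' : star φ ⬝ᵥ ψ = γ := by
    rw [dotProduct_comm, ← star_star φ, dotProduct_star, star_star, dotProduct_comm, hγ]; simp
  rw [hγ] at hψφ
  rw [hγ'] at hφψ
  rw [hψ, one_pow] at hψψ
  rw [hφ, one_pow] at hφφ
  generalize tensorPower ψ k = u at *
  generalize tensorPower φ k = v at *
  -- `E` has expectation at least `2/3` in `u` and at most `1/3` in `v`, whence `1/18 ≤ ‖u - v‖²`.
  have e1 := two_mul_quadForm_le hpos u v
  have e2 := (Complex.le_def.1 (hone.dotProduct_mulVec_nonneg v)).1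
  have e3 := (Complex.le_def.1 (hone'.dotProduct_mulVec_nonneg (u - v))).1
  have e4 : (star (u - v) ⬝ᵥ (u - v)).re = 2 - 2 * γ ^ k := by
    simp only [star_sub, dotProduct_sub, sub_dotProduct, hψφ, hφψ, hψψ, hφφ, ← Complex.ofReal_pow]
    simp only [Complex.sub_re, Complex.ofReal_re, Complex.one_re]
    ring
  rw [sub_mulVec, dotProduct_sub, one_mulVec] at e2 e3
  rw [hφφ, add_mulVec, dotProduct_add] at e2
  simp only [Complex.sub_re, Complex.add_re, Complex.zero_re, Complex.one_re] at e2 e3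
  have e5 := one_add_mul_le_pow (a := γ - 1) (by linarith) k
  rw [add_sub_cancel] at e5
  linarith

end Distinguish

/-! ### Circuits with a trivial ancilla -/

section Functions

variable {d : ℕ}

/-- The vector `ψ`, with a one-dimensional ancilla adjoined. -/
noncomputable def withAncilla (ψ : Fin d → ℂ) : Fin d × Fin 1 → ℂ := fun p => ψ p.1

theorem star_withAncilla_dotProduct (ψ φ : Fin d → ℂ) :
    star (withAncilla ψ) ⬝ᵥ withAncilla φ = star ψ ⬝ᵥ φ := by
  simp [dotProduct, withAncilla, Fintype.sum_prod_type]

theorem kronecker_one_mulVec_withAncilla (G : Matrix (Fin d) (Fin d) ℂ) (ψ : Fin d → ℂ) :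
    (G ⊗ₖ (1 : Matrix (Fin 1) (Fin 1) ℂ)) *ᵥ withAncilla ψ = withAncilla (G *ᵥ ψ) := by
  ext p
  simp [mulVec, dotProduct, withAncilla, Fintype.sum_prod_type, one_apply, Subsingleton.elim p.2 0]

/-- A circuit that uses the same gate `G` after each exponential is a power. -/
theorem dmeCircuit_eq_pow_kronecker (ρ : DensityMatrix (Fin d)) (G : Matrix (Fin d) (Fin d) ℂ)
    {a : ℕ} (M : ℕ) (V : Fin (M + 1) → Matrix (Fin d × Fin a) (Fin d × Fin a) ℂ) (hV0 : V 0 = 1)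
    (hV : ∀ i, i ≠ 0 → V i = G ⊗ₖ (1 : Matrix (Fin a) (Fin a) ℂ)) (T : ℝ) :
    dmeCircuit ρ M V (fun _ => T) = ((G * dmExp ρ T) ^ M) ⊗ₖ (1 : Matrix (Fin a) (Fin a) ℂ) := by
  induction M with
  | zero => simp [dmeCircuit, hV0]
  | succ M ih =>
    rw [dmeCircuit, ih _ (by simpa using hV0) (fun i hi => hV _ (by simpa using hi)),
      hV _ (Fin.last_pos.ne'), ← mul_kronecker_mul, ← mul_kronecker_mul, pow_succ']
    simp

/-- The function of a circuit with one-dimensional ancilla and observable `2|s⟩⟨s| - 1`. -/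
noncomputable def signFunction {M : ℕ} (V : Fin (M + 1) → unitaryGroup (Fin d × Fin 1) ℂ)
    (T : Fin M → ℝ) (hT : ∀ m, |T m| ≤ 1) (σ : InitialState d 1) (s : Fin d → ℂ) (hs : star s ⬝ᵥ s = 1) :
    DMEFunction d M where
  a := 1
  V := V
  T := T
  abs_T_le_one := hT
  σ := σ
  O := signObservable (withAncilla s)
  isHermitian_O := signObservable_isHermitian _
  O_le_one := one_sub_signObservable_posSemidef (by rw [star_withAncilla_dotProduct, hs])
  neg_one_le_O := one_add_signObservable_posSemidef _

/-- If the circuit carries the pure initial state `v` to `w`, then the value is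
`2 |⟨s, w⟩|² - ‖w‖²`. -/
theorem signFunction_value {M : ℕ} {V : Fin (M + 1) → unitaryGroup (Fin d × Fin 1) ℂ}
    {T : Fin M → ℝ} (hT : ∀ m, |T m| ≤ 1) {σ : InitialState d 1} {s : Fin d → ℂ}
    (hs : star s ⬝ᵥ s = 1) {ρ : DensityMatrix (Fin d)} {W : Matrix (Fin d) (Fin d) ℂ}
    {v w : Fin d → ℂ}
    (hU : dmeCircuit ρ M (fun i => (V i : Matrix (Fin d × Fin 1) (Fin d × Fin 1) ℂ)) T =
      W ⊗ₖ (1 : Matrix (Fin 1) (Fin 1) ℂ))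
    (hσ : σ.toMatrix ρ = vecMulVec (withAncilla v) (star (withAncilla v))) (hw : W *ᵥ v = w) :
    (signFunction V T hT σ s hs).value ρ =
      (2 * (star s ⬝ᵥ w) * (star w ⬝ᵥ s) - star w ⬝ᵥ w).re := by
  change (signObservable (withAncilla s) * dmeCircuit ρ M (fun i => (V i : Matrix _ _ ℂ)) T *
    σ.toMatrix ρ * (dmeCircuit ρ M (fun i => (V i : Matrix _ _ ℂ)) T)ᴴ).trace.re = _
  rw [hU, hσ, trace_mul_conj_vecMulVec_star, dotProduct_signObservable_mulVec,
    kronecker_one_mulVec_withAncilla, hw]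
  simp only [star_withAncilla_dotProduct]

/-- The function `ρ ↦ tr[(2|s⟩⟨s| - 1) ρ]`, as a circuit with one exponential of time zero whose
initial state is a copy of `ρ`. -/
noncomputable def overlapFunction (s : Fin d → ℂ) (hs : star s ⬝ᵥ s = 1) : DMEFunction d 1 :=
  signFunction (fun _ => 1) (fun _ => 0) (by simp)
    (.withCopy (pureState (n := Fin 1) (fun _ => 1) (by simp [dotProduct]))) s hs

theorem overlapFunction_value (s : Fin d → ℂ) (hs : star s ⬝ᵥ s = 1) (ψ : Fin d → ℂ)
    (hψ : star ψ ⬝ᵥ ψ = 1) :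
    (overlapFunction s hs).value (pureState ψ hψ) =
      (2 * (star s ⬝ᵥ ψ) * (star ψ ⬝ᵥ s) - 1).re := by
  have hU := dmeCircuit_eq_pow_kronecker (pureState ψ hψ) 1 1
    (fun _ => ((1 : unitaryGroup (Fin d × Fin 1) ℂ) :
      Matrix (Fin d × Fin 1) (Fin d × Fin 1) ℂ))
    (by simp) (by simp) 0
  rw [overlapFunction, signFunction_value _ hs hU (v := ψ) (w := ψ), hψ]
  · ext p q
    simp [InitialState.toMatrix, pureState, vecMulVec_apply, withAncilla]
  · simp [dmExp]

/-- The phase `e^{-i}` that the exponential `e^{-iρ}` of a pure state `ρ` gives to its vector. -/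
noncomputable def unitPhase : ℂ := Complex.exp (-Complex.I)

theorem star_unitPhase_mul_self : star unitPhase * unitPhase = 1 := by
  simp [unitPhase, ← Complex.exp_conj, ← Complex.exp_add]

/-- The circuit `(e^{i|ψ⟩⟨ψ|} e^{-iρ})^M`, which undoes each exponential in the case `ρ = |ψ⟩⟨ψ|`;
the initial state is `s` and the observable `2|s⟩⟨s| - 1`. -/
noncomputable def echoFunction (M : ℕ) (ψ : Fin d → ℂ) (hψ : star ψ ⬝ᵥ ψ = 1) (s : Fin d → ℂ)
    (hs : star s ⬝ᵥ s = 1) : DMEFunction d M :=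
  signFunction
    (fun i => if i = 0 then 1 else
      ⟨phaseGate ψ (star unitPhase) ⊗ₖ (1 : Matrix (Fin 1) (Fin 1) ℂ),
        phaseGate_kronecker_one_mem_unitaryGroup hψ
          (by rw [star_star, star_unitPhase_mul_self]) _⟩)
    (fun _ => 1) (by simp)
    (.known (pureState (withAncilla s) (by rw [star_withAncilla_dotProduct, hs]))) s hs

theorem echoFunction_value (M : ℕ) {ψ φ s v : Fin d → ℂ} (hψ : star ψ ⬝ᵥ ψ = 1)
    (hs : star s ⬝ᵥ s = 1) (hφ : star φ ⬝ᵥ φ = 1)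
    (hv : (phaseGate ψ (star unitPhase) * phaseGate φ unitPhase) ^ M *ᵥ s = v) :
    (echoFunction M ψ hψ s hs).value (pureState φ hφ) =
      (2 * (star s ⬝ᵥ v) * (star v ⬝ᵥ s) - star v ⬝ᵥ v).re := by
  refine signFunction_value _ hs (dmeCircuit_eq_pow_kronecker _ (phaseGate ψ (star unitPhase))
    M _ (by simp) (fun i hi => by simp [hi]) 1) rfl ?_
  rw [dmExp_pureState, ← hv]
  simp [unitPhase]

end Functions

/-! ### Two close states that the circuit separates -/

/-- The numbers `c = cos α` and `s = sin α` with `sin (1 / 2) * sin (2α) = sin (π / (4M))` and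
`0 ≤ α ≤ π / 4`. The bound `2 ≤ M` ensures that `π / (4M) ≤ 1 / 2`. -/
theorem exists_angle {M : ℕ} (hM : 2 ≤ M) :
    ∃ c s : ℝ, c ^ 2 + s ^ 2 = 1 ∧ 0 ≤ c ^ 2 - s ^ 2 ∧
      Real.sin (1 / 2) * (2 * c * s) = Real.sin (Real.pi / (4 * M)) := by
  have hM' : (2 : ℝ) ≤ M := by exact_mod_cast hM
  have hh : 0 < Real.sin (1 / 2) :=
    Real.sin_pos_of_pos_of_lt_pi (by norm_num) (by linarith [Real.pi_gt_three])
  have hle : Real.pi / (4 * M) ≤ 1 / 2 := by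
    rw [div_le_iff₀ (by positivity)]
    linarith [Real.pi_le_four]
  have h0 : 0 ≤ Real.pi / (4 * M) := by positivity
  have hq0 : 0 ≤ Real.sin (Real.pi / (4 * M)) :=
    Real.sin_nonneg_of_nonneg_of_le_pi h0 (by linarith [Real.pi_gt_three])
  have hq1 : Real.sin (Real.pi / (4 * M)) / Real.sin (1 / 2) ≤ 1 := by
    rw [div_le_one hh]
    exact Real.sin_le_sin_of_le_of_le_pi_div_two (by linarith [Real.pi_pos])
      (by linarith [Real.pi_gt_three]) hle
  have hq0' := div_nonneg hq0 hh.le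
  set q := Real.sin (Real.pi / (4 * M)) / Real.sin (1 / 2) with hq
  refine ⟨Real.cos (Real.arcsin q / 2), Real.sin (Real.arcsin q / 2), Real.cos_sq_add_sin_sq _,
    ?_, ?_⟩
  · rw [← Real.cos_two_mul', mul_div_cancel₀ _ two_ne_zero]
    exact Real.cos_arcsin_nonneg q
  · have : 2 * Real.cos (Real.arcsin q / 2) * Real.sin (Real.arcsin q / 2) = q := by
      rw [mul_right_comm, ← Real.sin_two_mul, mul_div_cancel₀ _ two_ne_zero,
        Real.sin_arcsin (by linarith) hq1]
    rw [this, hq, mul_div_cancel₀ _ hh.ne']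

/-- The `M`-fold rotation by `π / (2M)` carries `e_i` to a multiple of `e_j`. -/
theorem echo_pow_mulVec {n : Type} [Fintype n] [DecidableEq n] {i j : n} (hij : i ≠ j) {M : ℕ}
    (hM : 2 ≤ M) {c s : ℝ} (hcs : c ^ 2 + s ^ 2 = 1)
    (hq : Real.sin (1 / 2) * (2 * c * s) = Real.sin (Real.pi / (4 * M))) :
    ∃ τ : ℂ, star τ * τ = 1 ∧
      (phaseGate (planeVec i j c s) (star unitPhase) *
        phaseGate (planeVec i j c (-s)) unitPhase) ^ M *ᵥ planeVec i j 1 0 =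
      planeVec i j 0 τ := by
  have hM' : (2 : ℝ) ≤ M := by exact_mod_cast hM
  have hω := star_unitPhase_mul_self
  set ω := unitPhase with hωdef
  set θ : ℝ := Real.pi / (2 * M) with hθ
  have hθ2 : θ = 2 * (Real.pi / (4 * M)) := by rw [hθ]; field_simp; norm_num
  have hsin : 0 < Real.sin θ := by
    apply Real.sin_pos_of_pos_of_lt_pi (by positivity)
    rw [hθ]
    exact div_lt_self Real.pi_pos (by linarith)
  have hsinC : (Real.sin θ : ℂ) ≠ 0 := by exact_mod_cast hsin.ne'
  have hD : 2 - ω - star ω = ((4 * Real.sin (1 / 2) ^ 2 : ℝ) : ℂ) := by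
    have h1 : ω + star ω = ((2 * Real.cos 1 : ℝ) : ℂ) := by
      rw [Complex.star_def, Complex.add_conj, hωdef, unitPhase, Complex.exp_re]
      simp
    have h2 : Real.cos 1 = 1 - 2 * Real.sin (1 / 2) ^ 2 := by
      rw [← Real.cos_two_mul_eq_one_sub]; norm_num
    rw [sub_sub, h1, h2]
    push_cast
    ring
  have hcos : (1 - 2 * (2 - ω - star ω) * c ^ 2 * s ^ 2 : ℂ) = Real.cos θ := by
    rw [hD, hθ2, Real.cos_two_mul_eq_one_sub, ← hq]
    push_cast
    ring
  -- `t` is the lower left entry of the matrix on the plane; its phase is the phase of the basis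
  -- vector at `j`, and its modulus is `sin θ` because the matrix is unitary.
  set t : ℂ := c * s * (star ω - ω + (2 - ω - star ω) * (c ^ 2 - s ^ 2)) with ht
  have htt : star t * t = (Real.sin θ : ℂ) ^ 2 := by
    have h1 : (Real.sin θ : ℂ) ^ 2 = 1 - (Real.cos θ : ℂ) ^ 2 := by
      exact_mod_cast Real.sin_sq θ
    have hc : (c : ℂ) ^ 2 + (s : ℂ) ^ 2 = 1 := by exact_mod_cast hcs
    rw [h1, ← hcos, ht]
    simp only [star_add, star_sub, star_mul', star_pow, star_ofNat, Complex.star_def,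
      Complex.conj_ofReal, Complex.conj_conj] at hω ⊢
    generalize (starRingEnd ℂ) ω = ω' at hω ⊢
    linear_combination ((c : ℂ) ^ 2 * s ^ 2 * 4) * hω +
      (c ^ 2 * s ^ 2 * (2 - ω - ω') ^ 2 * (c ^ 2 + s ^ 2 + 1)) * hc
  refine ⟨t / Real.sin θ, ?_, ?_⟩
  · rw [star_div₀, div_mul_div_comm, htt, Complex.star_def, Complex.conj_ofReal, ← pow_two,
      div_self (pow_ne_zero 2 hsinC)]
  · have hτ : t / Real.sin θ * Real.sin θ = t := div_mul_cancel₀ _ hsinC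
    rw [pow_mulVec_planeVec (θ := θ) (τ := t / Real.sin θ)]
    · have : (M : ℝ) * θ = Real.pi / 2 := by rw [hθ]; field_simp
      simp [this]
    · rw [star_div₀, div_mul_div_comm, htt, Complex.star_def, Complex.conj_ofReal, ← pow_two,
        div_self (pow_ne_zero 2 hsinC)]
    · intro x y
      rw [hτ, phaseGate_mul_phaseGate_mulVec_planeVec hij c s hcs hω, hcos]

/-- There are two pure states at distance `O(1 / M)` on which some function takes the extreme values
`1` and `-1`. -/
theorem exists_dmeFunction_separating {d M : ℕ} (hd : 2 ≤ d) (hM : 1 ≤ M) :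
    ∃ (f : DMEFunction d M) (ψ φ : Fin d → ℂ) (hψ : star ψ ⬝ᵥ ψ = 1) (hφ : star φ ⬝ᵥ φ = 1)
      (γ : ℝ), star ψ ⬝ᵥ φ = γ ∧ 0 ≤ γ ∧
      Real.sin (1 / 2) ^ 2 * (1 - γ) ≤ (Real.pi / (4 * M)) ^ 2 ∧
      f.value (pureState ψ hψ) = 1 ∧ f.value (pureState φ hφ) = -1 := by
  obtain ⟨i, j, hij⟩ : ∃ i j : Fin d, i ≠ j :=
    ⟨⟨0, by omega⟩, ⟨1, by omega⟩, by simp⟩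
  have hs : star (planeVec i j 1 0) ⬝ᵥ planeVec i j 1 0 = 1 := by
    simp [star_planeVec_dotProduct hij]
  rcases hM.eq_or_lt with rfl | hM
  · have hs' : star (planeVec i j 0 1) ⬝ᵥ planeVec i j 0 1 = 1 := by
      simp [star_planeVec_dotProduct hij]
    refine ⟨overlapFunction _ hs, _, _, hs, hs', 0, ?_, le_rfl, ?_, ?_, ?_⟩
    · simp [star_planeVec_dotProduct hij]
    · have h1 : Real.sin (1 / 2) ≤ 1 / 2 := Real.sin_le (by norm_num)
      have h2 : 0 ≤ Real.sin (1 / 2) :=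
        Real.sin_nonneg_of_nonneg_of_le_pi (by norm_num) (by linarith [Real.pi_gt_three])
      have h3 := Real.pi_gt_three
      push_cast
      nlinarith
    · rw [overlapFunction_value]
      norm_num [star_planeVec_dotProduct hij]
    · rw [overlapFunction_value]
      norm_num [star_planeVec_dotProduct hij]
  · obtain ⟨c, s, hcs, hγ, hq⟩ := exists_angle hM
    have hcsC : (c : ℂ) ^ 2 + (s : ℂ) ^ 2 = 1 := by exact_mod_cast hcs
    have hψ : star (planeVec i j c s) ⬝ᵥ planeVec i j c s = 1 := by
      simp only [star_planeVec_dotProduct hij, Complex.star_def, Complex.conj_ofReal]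
      linear_combination hcsC
    have hφ : star (planeVec i j c (-s)) ⬝ᵥ planeVec i j c (-s) = 1 := by
      simp only [star_planeVec_dotProduct hij, Complex.star_def, Complex.conj_ofReal, map_neg]
      linear_combination hcsC
    obtain ⟨τ, hτ, hpow⟩ := echo_pow_mulVec hij hM hcs hq
    refine ⟨echoFunction M _ hψ _ hs, _, _, hψ, hφ, c ^ 2 - s ^ 2, ?_, hγ, ?_, ?_, ?_⟩
    · simp only [star_planeVec_dotProduct hij, Complex.star_def, Complex.conj_ofReal]
      push_cast
      ring
    · have h1 : 1 - (c ^ 2 - s ^ 2) ≤ (2 * c * s) ^ 2 := by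
        have : c ^ 2 = 1 - s ^ 2 := by linarith
        rw [mul_pow, mul_pow, this]
        rw [this] at hγ
        nlinarith [sq_nonneg s]
      have h0 : 0 ≤ Real.pi / (4 * M) := by positivity
      calc Real.sin (1 / 2) ^ 2 * (1 - (c ^ 2 - s ^ 2))
          ≤ Real.sin (1 / 2) ^ 2 * (2 * c * s) ^ 2 := by gcongr
        _ = Real.sin (Real.pi / (4 * M)) ^ 2 := by rw [← mul_pow, hq]
        _ ≤ (Real.pi / (4 * M)) ^ 2 := by
            rw [sq_le_sq, abs_of_nonneg h0]
            exact Real.abs_sin_le_abs.trans (abs_of_nonneg h0).le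
    · rw [echoFunction_value (v := planeVec i j 1 0), hs]
      · norm_num
      · rw [phaseGate_mul_phaseGate hψ, star_unitPhase_mul_self, phaseGate_one, one_pow, one_mulVec]
    · rw [echoFunction_value (hv := hpow)]
      simp only [star_planeVec_dotProduct hij, hτ]
      simp

theorem theorem3 (ε : ℝ) (hε0 : 0 < ε) (hε1 : ε < 1) :
    ∃ c : ℝ, 0 < c ∧ ∀ d : ℕ, 2 ≤ d → ∀ M : ℕ, 1 ≤ M →
      ∃ f : DMEFunction d M,
        (∀ (k : ℕ) (A : QuantumEstimator d k),
          A.Estimates f.value ε Set.univ → c * (M : ℝ) ^ 2 ≤ (k : ℝ)) ∧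
        (∀ (k : ℕ) (A : QuantumEstimator d k),
          A.Estimates f.value ε {ρ | ρ.IsPure} → c * (M : ℝ) ^ 2 ≤ (k : ℝ)) := by
  have hsin : 0 < Real.sin (1 / 2) :=
    Real.sin_pos_of_pos_of_lt_pi (by norm_num) (by linarith [Real.pi_gt_three])
  refine ⟨4 * Real.sin (1 / 2) ^ 2 / (9 * Real.pi ^ 2), by positivity, fun d hd M hM => ?_⟩
  obtain ⟨f, ψ, φ, hψ, hφ, γ, hγ, hγ0, hγM, hfψ, hfφ⟩ := exists_dmeFunction_separating hd hM
  have hpure : ∀ (k : ℕ) (A : QuantumEstimator d k), A.Estimates f.value ε {ρ | ρ.IsPure} →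
      4 * Real.sin (1 / 2) ^ 2 / (9 * Real.pi ^ 2) * (M : ℝ) ^ 2 ≤ (k : ℝ) := by
    intro k A hA
    have hM' : (0 : ℝ) < M := by exact_mod_cast hM
    have h := hA.le_copies_mul hε1 hψ hφ hγ0 hγ hfψ hfφ
    have h2 : Real.sin (1 / 2) ^ 2 * (1 / 36) ≤ k * (Real.pi / (4 * M)) ^ 2 :=
      calc Real.sin (1 / 2) ^ 2 * (1 / 36) ≤ Real.sin (1 / 2) ^ 2 * (k * (1 - γ)) := by gcongr
        _ = k * (Real.sin (1 / 2) ^ 2 * (1 - γ)) := by ring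
        _ ≤ k * (Real.pi / (4 * M)) ^ 2 := by gcongr
    rw [div_pow, ← mul_div_assoc, ← mul_div_assoc (k : ℝ), le_div_iff₀ (by positivity)] at h2
    rw [div_mul_eq_mul_div, div_le_iff₀ (by positivity)]
    linarith
  exact ⟨f, fun k A hA => hpure k A fun ρ _ => hA ρ (Set.mem_univ ρ), hpure⟩
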